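/- **Theorem.** Let $\mathbb{F}$ be a field of characteristic $0$ and let $n>1$. Let $\mathrm{UT}_n=\mathrm{UT}_n(\mathbb{F})$ be the algebra of upper triangular $n\times n$ matrices, let $G$ be the free group freely generated by $\alpha_1,\dots,\alpha_{n-1}$, and let $g\mapsto g^\ast$ be the anti-automorphism of $G$ with $\alpha_i^\ast=\alpha_{n-i}$. Let $\eta$ be the $G$-grading on $\mathrm{UT}_n$ in which the matrix unit $e_{ij}$, $i\le j$, is homogeneous of degree $\alpha_i\alpha_{i+1}\cdots\alpha_{j-1}$. Let $\ast$ be either the orthogonal involution $\tau$ of $\mathrm{UT}_n$, given by $e_{ij}^\tau=e_{n-j+1,n-i+1}$, or, if $n=2k$ is even, the symplectic involution $A\mapsto DA^\tau D^{-1}$ with $D=\mathrm{diag}(I_k,-I_k)$; in both cases $\ast$ maps the component of degree $g$ into the component of degree $g^\ast$. Let $\mathbb{F}\langle X^G,\ast\rangle$ be the free $G$-graded associative algebra with involution on the variables $x_i^{(g)}$ ($g\in G$, $i\ge 1$), where $\deg x_i^{(g)}=g$ and $\deg (x_i^{(g)})^\ast=g^\ast$. Let $\mathrm{Id}$ be the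 set of all $f\in\mathbb{F}\langle X^G,\ast\rangle$ that vanish whenever every $x_i^{(g)}$ is replaced by an element of $\mathrm{UT}_n$ in the component of degree $g$ (and $(x_i^{(g)})^\ast$ by the image of that element under $\ast$). For $\mu=(g_1,\dots,g_m)\in G^m$ let $P_\mu^{(\ast)}$ be the span of all products $(x_{\sigma(1)}^{(g_{\sigma(1)})})^{\ast'}\cdots(x_{\sigma(m)}^{(g_{\sigma(m)})})^{\ast'}$, where $\sigma\in\mathcal{S}_m$ and each $\ast'$ is, independently, either $\ast$ or nothing. The $(G,\ast)$-codimension sequence of $(\mathrm{UT}_n,\eta,\ast)$ is $$c_m(\mathrm{UT}_n,\eta,\ast)=\dim\sum_{\mu\in G^m}P_\mu^{(\ast)}/\bigl(P_\mu^{(\ast)}\cap\mathrm{Id}\bigr),$$ the sum being taken in $\mathbb{F}\langle X^G,\ast\rangle/\mathrm{Id}$. Then, as $m\to\infty$, $$c_m(\mathrm{UT}_n,\eta,\ast)\sim\frac{2^{\lfloor\frac{n-1}{2}\rfloor}}{n^{n-1}}\,m^{n-1}n^m ,$$ that is, the quotient of the two sides tends to $1$. In particular, the $(G,\ast)$-exponent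 $\lim_{m\to\infty}\sqrt[m]{c_m(\mathrm{UT}_n,\eta,\ast)}$ exists and equals $n$. -/

import Mathlib

open Filter Topology Asymptotics

/-! ### Free graded algebra with a homogeneous involution, identities, codimensions -/

section General

variable {F G A : Type*} [Field F] [Ring A] [Algebra F A]

/-- The subspaces `𝒜 g`, `g ∈ G`, form a `G`-grading of the algebra `A`. -/
structure IsGrading [Mul G] (𝒜 : G → Submodule F A) : Prop where
  indep : iSupIndep 𝒜
  iSup_eq_top : ⨆ g, 𝒜 g = ⊤
  mul_mem : ∀ {g h : G} {a b : A}, a ∈ 𝒜 g → b ∈ 𝒜 h → a * b ∈ 𝒜 (g * h)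

/-- A homogeneous involution with respect to `ψ : G → G` on an algebra `A` with homogeneous
components `𝒜 g`: a linear anti-automorphism of order at most two mapping `𝒜 g` into
`𝒜 (ψ g)`. -/
structure HomogeneousInvolution (𝒜 : G → Submodule F A) (ψ : G → G) where
  toLin : A →ₗ[F] A
  map_mul : ∀ a b, toLin (a * b) = toLin b * toLin a
  involutive : ∀ a, toLin (toLin a) = a
  homogeneous : ∀ g, ∀ a ∈ 𝒜 g, toLin a ∈ 𝒜 (ψ g)

/-- The free `G`-graded associative algebra with involution `F⟨X^G, ∗⟩`. It is the free
associative algebra on the letters `x_i^{(g)}`, encoded as `((g, i), false)`, and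
`(x_i^{(g)})^∗`, encoded as `((g, i), true)`. The former has degree `g`, the latter has as degree
the image of `g` under the involution of `G`. -/
abbrev FreeStarAlgebra (F G : Type*) [Field F] : Type _ :=
  FreeAlgebra F ((G × ℕ) × Bool)

namespace FreeStarAlgebra

/-- The involution of the free algebra: it reverses words and exchanges
`x_i^{(g)}` with `(x_i^{(g)})^∗`. -/
noncomputable def star : FreeStarAlgebra F G →ₗ[F] FreeStarAlgebra F G :=
  (MulOpposite.opLinearEquiv F).symm.toLinearMap ∘ₗ
    (FreeAlgebra.lift F (fun v : (G × ℕ) × Bool =>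
      MulOpposite.op (FreeAlgebra.ι F (v.1, !v.2)))).toLinearMap

/-- The variable `x_i^{(g)}`. -/
noncomputable def var (F : Type*) {G : Type*} [Field F] (g : G) (i : ℕ) : FreeStarAlgebra F G :=
  FreeAlgebra.ι F ((g, i), false)

/-- `x_i^{(g)}` for `b = false` and `(x_i^{(g)})^∗` for `b = true`. -/
noncomputable def starVar (F : Type*) {G : Type*} [Field F] (g : G) (i : ℕ) (b : Bool) :
    FreeStarAlgebra F G :=
  if b then star (var F g i) else var F g i

theorem star_ι (v : (G × ℕ) × Bool) :
    star (FreeAlgebra.ι F v) = FreeAlgebra.ι F (v.1, !v.2) := by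
  simp [star]

theorem star_mul (f h : FreeStarAlgebra F G) : star (f * h) = star h * star f := by
  simp [star]

theorem starVar_eq (g : G) (i : ℕ) (b : Bool) :
    starVar F g i b = FreeAlgebra.ι F ((g, i), b) := by
  cases b <;> simp [starVar, var, star_ι]

end FreeStarAlgebra

namespace HomogeneousInvolution

variable {𝒜 : G → Submodule F A} {ψ : G → G}

/-- The evaluation of polynomials under the substitution `x_i^{(g)} ↦ a g i`,
`(x_i^{(g)})^∗ ↦ (a g i)^∗`. -/
noncomputable def eval (inv : HomogeneousInvolution 𝒜 ψ) (a : G → ℕ → A) :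
    FreeStarAlgebra F G →ₐ[F] A :=
  FreeAlgebra.lift F (fun v : (G × ℕ) × Bool =>
    if v.2 then inv.toLin (a v.1.1 v.1.2) else a v.1.1 v.1.2)

/-- `Id_{G,∗}(A)`: the graded polynomial identities with involution, that is, the polynomials
vanishing under each substitution of every `x_i^{(g)}` by an element of `𝒜 g`. -/
noncomputable def identities (inv : HomogeneousInvolution 𝒜 ψ) :
    Submodule F (FreeStarAlgebra F G) where
  carrier := {f | ∀ a : G → ℕ → A, (∀ g i, a g i ∈ 𝒜 g) → inv.eval a f = 0}
  add_mem' := by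
    intro f h hf hh a ha
    simp [hf a ha, hh a ha]
  zero_mem' := by
    intro a _
    simp
  smul_mem' := by
    intro c f hf a ha
    simp [hf a ha]

end HomogeneousInvolution

/-- `P_μ^{(∗)}` for `μ = (g_1, …, g_m)`: the span of all products
`(x_{σ(1)}^{(g_{σ(1)})})^{∗'} ⋯ (x_{σ(m)}^{(g_{σ(m)})})^{∗'}`, where `σ` is a permutation and
each factor carries `∗` or not. -/
noncomputable def multilinearStar (F : Type*) {G : Type*} [Field F] {m : ℕ} (μ : Fin m → G) :
    Submodule F (FreeStarAlgebra F G) :=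
  Submodule.span F (Set.range fun p : Equiv.Perm (Fin m) × (Fin m → Bool) =>
    (List.ofFn fun k : Fin m =>
      FreeStarAlgebra.starVar F (μ (p.1 k)) (p.1 k : ℕ) (p.2 k)).prod)

/-- The `(G,∗)`-codimension `c_m(A)`: the dimension of the sum, over all `μ ∈ G^m`, of
`P_μ^{(∗)} / (P_μ^{(∗)} ∩ Id_{G,∗}(A))`, seen as subspaces of the relatively free algebra
`F⟨X^G, ∗⟩ / Id_{G,∗}(A)`. -/
noncomputable def HomogeneousInvolution.codim {𝒜 : G → Submodule F A} {ψ : G → G}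
    (inv : HomogeneousInvolution 𝒜 ψ) (m : ℕ) : ℕ :=
  Module.finrank F
    ↥(⨆ μ : Fin m → G, (multilinearStar F μ).map inv.identities.mkQ)

/-- Evaluations are compatible with the involutions. -/
theorem HomogeneousInvolution.eval_star {𝒜 : G → Submodule F A} {ψ : G → G}
    (inv : HomogeneousInvolution 𝒜 ψ) (a : G → ℕ → A) (f : FreeStarAlgebra F G) :
    inv.eval a (FreeStarAlgebra.star f) = inv.toLin (inv.eval a f) := by
  have h1 : inv.toLin 1 = 1 := by
    have h := inv.map_mul (inv.toLin 1) 1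
    rw [mul_one, inv.involutive, mul_one] at h
    exact h.symm
  induction f using FreeAlgebra.induction with
  | grade0 r =>
    have : FreeStarAlgebra.star (algebraMap F (FreeStarAlgebra F G) r)
        = algebraMap F (FreeStarAlgebra F G) r := by
      simp [FreeStarAlgebra.star]
    rw [this, AlgHom.commutes, Algebra.algebraMap_eq_smul_one, map_smul, h1]
  | grade1 v =>
    obtain ⟨⟨g, i⟩, b⟩ := v
    cases b <;> simp [FreeStarAlgebra.star_ι, eval, inv.involutive]
  | mul f h hf hh =>
    rw [FreeStarAlgebra.star_mul, _root_.map_mul, _root_.map_mul, inv.map_mul, hf, hh]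
  | add f h hf hh => simp only [map_add, hf, hh]

end General

/-! ### Upper triangular matrices -/

namespace UT

/-- The algebra `UT_n(F)` of upper triangular matrices (rows and columns are numbered from `0`). -/
def algebra (F : Type*) [Field F] (n : ℕ) : Subalgebra F (Matrix (Fin n) (Fin n) F) where
  carrier := {M | ∀ i j, j < i → M i j = 0}
  mul_mem' := by
    intro M N hM hN
    exact Matrix.BlockTriangular.mul (b := id) (fun i j h => hM i j h) (fun i j h => hN i j h)
  add_mem' := by
    intro M N hM hN i j h
    simp [hM i j h, hN i j h]
  algebraMap_mem' := by
    intro r i j h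
    simp [Matrix.algebraMap_matrix_apply, h.ne']

/-- The degree `g_i g_{i+1} ⋯ g_{j-1}` of the matrix unit `e_{ij}`, `i ≤ j`, in the elementary
grading given by `η = (g_1, …, g_{n-1})`. -/
def degree {H : Type*} [Group H] {n : ℕ} (η : Fin (n - 1) → H) (i j : Fin n) : H :=
  (((List.ofFn η).take j).drop i).prod

theorem degree_self {H : Type*} [Group H] {n : ℕ} (η : Fin (n - 1) → H) (i : Fin n) :
    degree η i i = 1 := by
  have : ((List.ofFn η).take i).drop i = [] := by
    rw [List.drop_eq_nil_iff]
    exact List.length_take_le _ _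
  simp [degree, this]

theorem degree_mul {H : Type*} [Group H] {n : ℕ} (η : Fin (n - 1) → H) {i j k : Fin n}
    (hij : i ≤ j) (hjk : j ≤ k) : degree η i j * degree η j k = degree η i k := by
  have key : ∀ a b : Fin n, a ≤ b →
      ((List.ofFn η).take a).prod * degree η a b = ((List.ofFn η).take b).prod := by
    intro a b hab
    have h := List.prod_take_mul_prod_drop ((List.ofFn η).take b) a
    rwa [List.take_take, min_eq_left (show (a : ℕ) ≤ b from hab)] at h
  apply mul_left_cancel (a := ((List.ofFn η).take i).prod)
  rw [← mul_assoc, key i j hij, key j k hjk, key i k (hij.trans hjk)]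

/-- The component of degree `g` of the elementary grading on `UT_n` given by `η`, that is, the
span of the matrix units `e_{ij}`, `i ≤ j`, of degree `g`. -/
def grading (F : Type*) [Field F] {H : Type*} [Group H] {n : ℕ} (η : Fin (n - 1) → H) (g : H) :
    Submodule F (algebra F n) where
  carrier := {M | ∀ i j, M.1 i j ≠ 0 → degree η i j = g}
  add_mem' := by
    intro M N hM hN i j h
    by_cases h1 : M.1 i j = 0
    · apply hN i j
      intro h2
      exact h (by simp [h1, h2])
    · exact hM i j h1
  zero_mem' := by
    intro i j h
    simp at h
  smul_mem' := by
    intro c M hM i j h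
    apply hM i j
    intro h1
    exact h (by simp [h1])

/-- The elementary grading given by `η` is a grading by the group. -/
theorem isGrading (F : Type*) [Field F] {H : Type*} [Group H] {n : ℕ} (η : Fin (n - 1) → H) :
    IsGrading (grading F η) where
  indep := by
    intro g
    rw [Submodule.disjoint_def]
    intro M hM hM'
    let p : Submodule F (algebra F n) :=
      { carrier := {M | ∀ i j, degree η i j = g → M.1 i j = 0}
        add_mem' := by
          intro M N hM hN i j h
          simp [hM i j h, hN i j h]
        zero_mem' := by
          intro i j _
          simp
        smul_mem' := by
          intro c M hM i j h
          simp [hM i j h] }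
    have hp : (⨆ h, ⨆ (_ : h ≠ g), grading F η h) ≤ p := by
      refine iSup_le fun h => iSup_le fun hh => ?_
      intro N hN i j hij
      by_contra hne
      exact hh ((hN i j hne).symm.trans hij)
    ext i j
    by_contra hne
    exact hne (hp hM' i j (hM i j hne))
  iSup_eq_top := by
    rw [eq_top_iff]
    rintro M -
    have hu : ∀ i j, Matrix.single i j (M.1 i j) ∈ algebra F n := by
      intro i j a b hab
      by_cases h : i = a ∧ j = b
      · obtain ⟨rfl, rfl⟩ := h
        simpa using M.2 i j hab
      · exact Matrix.single_apply_of_ne _ _ _ _ _ h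
    have hM : M = ∑ i, ∑ j, (⟨Matrix.single i j (M.1 i j), hu i j⟩ : algebra F n) := by
      apply Subtype.ext
      simp only [AddSubmonoidClass.coe_finsetSum]
      exact Matrix.matrix_eq_sum_single M.1
    rw [hM]
    refine Submodule.sum_mem _ fun i _ => Submodule.sum_mem _ fun j _ => ?_
    refine Submodule.mem_iSup_of_mem (degree η i j) ?_
    intro a b hab
    by_cases h : i = a ∧ j = b
    · rw [h.1, h.2]
    · exact absurd (Matrix.single_apply_of_ne _ _ _ _ _ h) hab
  mul_mem := by
    intro g h M N hM hN i j hij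
    obtain ⟨k, -, hk⟩ := Finset.exists_ne_zero_of_sum_ne_zero
      (show ∑ k, M.1 i k * N.1 k j ≠ 0 from hij)
    have h1 := left_ne_zero_of_mul hk
    have h2 := right_ne_zero_of_mul hk
    have h3 : i ≤ k := not_lt.1 fun h => h1 (M.2 i k h)
    have h4 : k ≤ j := not_lt.1 fun h => h2 (N.2 k j h)
    rw [← degree_mul η h3 h4, hM i k h1, hN k j h2]

/-- The group `G`, free of rank `n - 1`. -/
abbrev Grp (n : ℕ) : Type := FreeGroup (Fin (n - 1))

/-- The sequence `η = (α_1, …, α_{n-1})` of free generators of `G`. -/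
def eta (n : ℕ) : Fin (n - 1) → Grp n := FreeGroup.of

/-- The anti-automorphism `∗` of order at most two of `G` with `α_i^∗ = α_{n-i}`. -/
def grpStar (n : ℕ) (g : Grp n) : Grp n :=
  (FreeGroup.lift (fun i : Fin (n - 1) => MulOpposite.op (eta n i.rev)) g).unop

theorem grpStar_eta (n : ℕ) (i : Fin (n - 1)) : grpStar n (eta n i) = eta n i.rev := by
  simp [grpStar, eta]

theorem grpStar_mul (n : ℕ) (g h : Grp n) :
    grpStar n (g * h) = grpStar n h * grpStar n g := by
  simp [grpStar]

theorem grpStar_list_prod (n : ℕ) (l : List (Fin (n - 1))) :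
    grpStar n (l.map (eta n)).prod = ((l.map Fin.rev).reverse.map (eta n)).prod := by
  induction l with
  | nil => simp [grpStar]
  | cons a l ih => simp [grpStar_mul, ih, grpStar_eta]

theorem grpStar_degree (n : ℕ) (i j : Fin n) (hij : i ≤ j) :
    grpStar n (degree (eta n) i j) = degree (eta n) j.rev i.rev := by
  have e : List.ofFn (eta n) = (List.finRange (n - 1)).map (eta n) := List.ofFn_eq_map
  unfold degree
  rw [e, ← List.map_take, ← List.map_drop, grpStar_list_prod, ← List.map_take, ← List.map_drop]
  congr 2
  have hi := i.2
  have hj := j.2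
  have hij' : (i : ℕ) ≤ j := hij
  apply List.ext_getElem
  · simp [Fin.val_rev]
    omega
  · intro k h1 h2
    simp only [List.length_reverse, List.length_map, List.length_drop, List.length_take,
      List.length_finRange] at h1
    ext
    simp [Fin.val_rev]
    omega

theorem reflect_mem (F : Type*) [Field F] (n : ℕ) {M : Matrix (Fin n) (Fin n) F}
    (hM : M ∈ algebra F n) : Matrix.of (fun i j => M j.rev i.rev) ∈ algebra F n :=
  fun _ _ h => hM _ _ (Fin.rev_lt_rev.2 h)

/-- Reflection along the secondary diagonal: `e_{ij} ↦ e_{n-j+1,n-i+1}`. -/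
def reflect (F : Type*) [Field F] (n : ℕ) : algebra F n →ₗ[F] algebra F n where
  toFun M := ⟨Matrix.of fun i j => M.1 j.rev i.rev, reflect_mem F n M.2⟩
  map_add' _ _ := rfl
  map_smul' _ _ := rfl

theorem reflect_apply (F : Type*) [Field F] (n : ℕ) (M : algebra F n) (i j : Fin n) :
    (reflect F n M).1 i j = M.1 j.rev i.rev := rfl

theorem reflect_mul (F : Type*) [Field F] (n : ℕ) (M N : algebra F n) :
    reflect F n (M * N) = reflect F n N * reflect F n M := by
  apply Subtype.ext
  ext i j
  rw [reflect_apply, MulMemClass.coe_mul, MulMemClass.coe_mul, Matrix.mul_apply,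
    Matrix.mul_apply, ← Equiv.sum_comp Fin.revPerm]
  refine Finset.sum_congr rfl fun k _ => ?_
  rw [reflect_apply, reflect_apply, mul_comm]
  rfl

theorem reflect_mem_grading (F : Type*) [Field F] (n : ℕ) (g : Grp n) (M : algebra F n)
    (hM : M ∈ grading F (eta n) g) : reflect F n M ∈ grading F (eta n) (grpStar n g) := by
  intro i j h
  rw [reflect_apply] at h
  have hle : j.rev ≤ i.rev := not_lt.1 fun hlt => h (M.2 _ _ hlt)
  have := grpStar_degree n _ _ hle
  rw [hM _ _ h, Fin.rev_rev, Fin.rev_rev] at this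
  exact this.symm

/-- The orthogonal involution `τ` on `UT_n`, the reflection along the secondary diagonal. -/
def orthogonal (F : Type*) [Field F] (n : ℕ) :
    HomogeneousInvolution (grading F (eta n)) (grpStar n) where
  toLin := reflect F n
  map_mul := reflect_mul F n
  involutive M := by
    apply Subtype.ext
    ext i j
    rw [reflect_apply, reflect_apply, Fin.rev_rev, Fin.rev_rev]
  homogeneous := reflect_mem_grading F n

/-- The matrix `D = diag(I_m, -I_m)`, where `n = 2m`. -/
def symplecticD (F : Type*) [Field F] (n : ℕ) : Matrix (Fin n) (Fin n) F :=
  Matrix.diagonal fun i => if (i : ℕ) < n / 2 then 1 else -1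

theorem symplecticD_inv (F : Type*) [Field F] (n : ℕ) :
    (symplecticD F n)⁻¹ = symplecticD F n := by
  apply Matrix.inv_eq_left_inv
  rw [symplecticD, Matrix.diagonal_mul_diagonal, ← Matrix.diagonal_one]
  congr 1
  ext i
  split_ifs <;> simp

theorem symplecticD_mem (F : Type*) [Field F] (n : ℕ) : symplecticD F n ∈ algebra F n :=
  fun _ _ h => Matrix.diagonal_apply_ne _ h.ne'

theorem conj_symplecticD_mem (F : Type*) [Field F] (n : ℕ) {M : Matrix (Fin n) (Fin n) F}
    (hM : M ∈ algebra F n) : symplecticD F n * M * (symplecticD F n)⁻¹ ∈ algebra F n := by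
  rw [symplecticD_inv]
  exact mul_mem (mul_mem (symplecticD_mem F n) hM) (symplecticD_mem F n)

theorem conj_symplecticD_apply (F : Type*) [Field F] (n : ℕ) (M : Matrix (Fin n) (Fin n) F)
    (i j : Fin n) : (symplecticD F n * M * (symplecticD F n)⁻¹) i j =
      (if (i : ℕ) < n / 2 then 1 else -1) * M i j * (if (j : ℕ) < n / 2 then 1 else -1) := by
  rw [symplecticD_inv, symplecticD, Matrix.mul_diagonal, Matrix.diagonal_mul]

/-- The map `A ↦ D A^τ D⁻¹` on `UT_n`. -/
noncomputable def conjReflect (F : Type*) [Field F] (n : ℕ) :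
    algebra F n →ₗ[F] algebra F n where
  toFun M := ⟨symplecticD F n * (reflect F n M).1 * (symplecticD F n)⁻¹,
    conj_symplecticD_mem F n (reflect F n M).2⟩
  map_add' M N := by
    apply Subtype.ext
    simp [mul_add, add_mul]
  map_smul' c M := by
    apply Subtype.ext
    simp

theorem conjReflect_apply (F : Type*) [Field F] (n : ℕ) (M : algebra F n) (i j : Fin n) :
    (conjReflect F n M).1 i j = (if (i : ℕ) < n / 2 then 1 else -1) * M.1 j.rev i.rev *
      (if (j : ℕ) < n / 2 then 1 else -1) :=
  conj_symplecticD_apply F n _ i j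

/-- The symplectic involution `s` on `UT_n`, `n` even: `A^s = D A^τ D⁻¹`. -/
noncomputable def symplectic (F : Type*) [Field F] (n : ℕ) (hn : Even n) :
    HomogeneousInvolution (grading F (eta n)) (grpStar n) where
  toLin := conjReflect F n
  map_mul M N := by
    apply Subtype.ext
    ext i j
    rw [conjReflect_apply, ← reflect_apply, reflect_mul, MulMemClass.coe_mul,
      MulMemClass.coe_mul, Matrix.mul_apply, Matrix.mul_apply, Finset.mul_sum, Finset.sum_mul]
    refine Finset.sum_congr rfl fun k _ => ?_
    rw [conjReflect_apply, conjReflect_apply, reflect_apply, reflect_apply]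
    split_ifs <;> ring
  involutive M := by
    apply Subtype.ext
    ext i j
    have hi := i.2
    have hj := j.2
    obtain ⟨k, hk⟩ := hn
    rw [conjReflect_apply, conjReflect_apply, Fin.rev_rev, Fin.rev_rev, Fin.val_rev, Fin.val_rev]
    split_ifs <;> first | omega | ring
  homogeneous g M hM i j h := by
    apply reflect_mem_grading F n g M hM i j
    intro h0
    apply h
    rw [reflect_apply] at h0
    rw [conjReflect_apply, h0]
    simp

end UT

/-! An entry of a word evaluated on homogeneous matrices is a sum over paths of row indices. Once
the row is fixed, the degree of a letter determines the column, so at most one path contributes.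
Each entry `(i, j)` of a word is therefore either identically zero or a nonzero scalar, coming from
the involution, times a single monomial in which variable `l` contributes its entry at a position `κ
l`. Hence the codimension is at most the number of triples `(κ, i, j)` realized by paths
(`codim_le_card_attained`).

A path is nondecreasing in `{0, …, n - 1}`, so it has at most `n - 1` off-diagonal steps. If it has
exactly `n - 1`, all of them have length one, the ends are `0` and `n - 1`, and `κ` is full: `n - 1`
places carry superdiagonal positions, where a star replaces position `k` by its mirror image `n - 2
- k`, and all other places are diagonal (`IsPath.card_le_or_isFull`). Conversely, every full `κ`
comes from a word (`IsFull.exists_isPath`), and substitutions of matrix units separate these words,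
so the full `κ` also bound the codimension from below (`card_isFull_le_codim`).

The remaining triples number `O(m^(n-2) n^m)`. The full `κ` are counted exactly in `card_isFull`:
the `n - 1` places are chosen in order, each mirror pair contributes a net factor `2`, and there are
`⌊(n-1)/2⌋` such pairs. This count gives the asymptotics. -/

namespace UT

/-! ### Counting the full assignments of positions. -/

/-- The position `(k, k + 1)` just above the diagonal. -/
def superdiag {n : ℕ} (k : Fin (n - 1)) : Fin n × Fin n :=
  (⟨k, by omega⟩, ⟨k + 1, by omega⟩)

theorem superdiag_injective {n : ℕ} : Function.Injective (superdiag (n := n)) := by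
  intro a b h
  simp only [superdiag, Prod.mk.injEq, Fin.mk.injEq] at h
  exact Fin.ext h.1

theorem superdiag_fst_ne_snd {n : ℕ} (k : Fin (n - 1)) :
    (superdiag k).1 ≠ (superdiag k).2 := by
  simp [superdiag]

/-- The representative of the orbit of `k` under `Fin.rev`. -/
def orbitRep {N : ℕ} (k : Fin N) : Fin N := min k k.rev

theorem orbitRep_eq_iff {N : ℕ} (a b : Fin N) : orbitRep a = orbitRep b ↔ a = b ∨ a = b.rev := by
  simp only [orbitRep, Fin.ext_iff, Fin.coe_min, Fin.val_rev]
  omega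

theorem card_filter_lt_rev (N : ℕ) :
    (Finset.univ.filter fun k : Fin N => k < k.rev).card = N / 2 := by
  have h : (Finset.univ.filter fun k : Fin N => k < k.rev)
      = Finset.univ.filter fun k : Fin N => (k : ℕ) < N / 2 := by
    ext k
    simp only [Finset.mem_filter, Finset.mem_univ, true_and, Fin.lt_def, Fin.val_rev]
    omega
  rw [h, Fin.card_filter_val_lt]
  omega

theorem card_filter_ne_rev (N : ℕ) :
    (Finset.univ.filter fun k : Fin N => k ≠ k.rev).card = 2 * (N / 2) := by
  have h : (Finset.univ.filter fun k : Fin N => k ≠ k.rev)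
      = (Finset.univ.filter fun k : Fin N => k < k.rev)
        ∪ (Finset.univ.filter fun k : Fin N => k < k.rev).map Fin.revPerm.toEmbedding := by
    ext k
    simp only [Finset.mem_filter, Finset.mem_univ, true_and, Finset.mem_union, Finset.mem_map_equiv,
      Fin.revPerm_symm, Fin.revPerm_apply, Fin.rev_rev]
    exact lt_or_lt_iff_ne.symm
  rw [h, Finset.card_union_of_disjoint, Finset.card_map, card_filter_lt_rev, two_mul]
  rw [Finset.disjoint_left]
  intro k hk hk'
  simp only [Finset.mem_filter, Finset.mem_univ, true_and, Finset.mem_map_equiv,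
      Fin.revPerm_symm, Fin.revPerm_apply, Fin.rev_rev] at hk hk'
  exact lt_asymm hk hk'

theorem card_orbitRep_preserving (N : ℕ) :
    (Finset.univ.filter fun f : Fin N → Fin N => ∀ k, orbitRep (f k) = orbitRep k).card
      = 2 ^ (2 * (N / 2)) := by
  have h : (Finset.univ.filter fun f : Fin N → Fin N => ∀ k, orbitRep (f k) = orbitRep k)
      = Fintype.piFinset fun k : Fin N => ({k, k.rev} : Finset (Fin N)) := by
    ext f
    simp [Fintype.mem_piFinset, orbitRep_eq_iff]
  have h2 : ∀ k : Fin N, ({k, k.rev} : Finset (Fin N)).card = if k ≠ k.rev then 2 else 1 := by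
    intro k
    split_ifs with hk
    · exact Finset.card_pair hk
    · rw [not_not] at hk
      rw [← hk]
      simp
  rw [h, Fintype.card_piFinset, Finset.prod_congr rfl fun k _ => h2 k, Finset.prod_ite,
    Finset.prod_const_one, mul_one, Finset.prod_const, card_filter_ne_rev]

/-- The stabilizer of a function has order the product of the factorials of its fibre sizes. Here a
fibre has two elements above the smaller member of a mirror pair and at most one elsewhere. -/
theorem card_perm_orbitRep (N : ℕ) :
    Fintype.card {g : Equiv.Perm (Fin N) // orbitRep ∘ g = orbitRep} = 2 ^ (N / 2) := by
  rw [DomMulAct.stabilizer_card, ← card_filter_lt_rev N, ← Finset.prod_const,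
    Finset.prod_filter]
  refine Finset.prod_congr rfl fun i _ => ?_
  rw [Fintype.card_subtype]
  split_ifs with hi
  · have : (Finset.univ.filter fun a : Fin N => orbitRep a = i) = {i, i.rev} := by
      ext a
      have hi' : orbitRep i = i := min_eq_left hi.le
      simp only [Finset.mem_filter, Finset.mem_univ, true_and, Finset.mem_insert,
        Finset.mem_singleton]
      rw [← orbitRep_eq_iff, hi']
    rw [this, Finset.card_pair hi.ne]
    rfl
  · have : (Finset.univ.filter fun a : Fin N => orbitRep a = i).card ≤ 1 := by
      rw [Finset.card_le_one]
      intro a ha b hb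
      simp only [Finset.mem_filter, Finset.mem_univ, true_and, orbitRep, Fin.ext_iff, Fin.coe_min,
        Fin.val_rev, Fin.lt_def] at ha hb hi ⊢
      omega
    exact Nat.factorial_eq_one.2 this

/-- `κ` assigns to the places in the image of `s` the positions `(f k, f k + 1)`, and to the
others diagonal positions. -/
def IsLabelling {n m : ℕ} (κ : Fin m → Fin n × Fin n) (s : Fin (n - 1) ↪ Fin m)
    (f : Fin (n - 1) → Fin (n - 1)) : Prop :=
  (∀ k, κ (s k) = superdiag (f k)) ∧ ∀ l, l ∉ Set.range s → (κ l).1 = (κ l).2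

/-- The assignments of positions that belong to nonzero words with the largest possible number
of variables of nontrivial degree. -/
def IsFull {n m : ℕ} (κ : Fin m → Fin n × Fin n) : Prop :=
  ∃ (s : Fin (n - 1) ↪ Fin m) (f : Fin (n - 1) → Fin (n - 1)),
    (∀ k, orbitRep (f k) = orbitRep k) ∧ IsLabelling κ s f

/-- The range of `s` is thus intrinsic to `κ`, so two labellings of the same `κ` differ only by a
permutation of the indices. -/
theorem IsLabelling.mem_range_iff {n m : ℕ} {κ : Fin m → Fin n × Fin n} {s : Fin (n - 1) ↪ Fin m}
    {f : Fin (n - 1) → Fin (n - 1)} (h : IsLabelling κ s f) (l : Fin m) :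
    l ∈ Set.range s ↔ (κ l).1 ≠ (κ l).2 := by
  constructor
  · rintro ⟨k, rfl⟩
    rw [h.1]
    exact superdiag_fst_ne_snd _
  · intro hl
    by_contra hn
    exact hl (h.2 l hn)

theorem card_diagonal (n : ℕ) :
    (Finset.univ.filter fun x : Fin n × Fin n => x.1 = x.2).card = n := by
  have : (Finset.univ.filter fun x : Fin n × Fin n => x.1 = x.2)
      = Finset.univ.image fun i : Fin n => (i, i) := by
    ext ⟨x, y⟩
    simp
  rw [this, Finset.card_image_of_injective _ (fun a b h => congrArg Prod.fst h), Finset.card_univ,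
    Fintype.card_fin]

open Classical in
theorem card_isLabelling {n m : ℕ} (s : Fin (n - 1) ↪ Fin m) (f : Fin (n - 1) → Fin (n - 1)) :
    (Finset.univ.filter fun κ : Fin m → Fin n × Fin n => IsLabelling κ s f).card
      = n ^ (m - (n - 1)) := by
  have h : (Finset.univ.filter fun κ : Fin m → Fin n × Fin n => IsLabelling κ s f)
      = Fintype.piFinset fun l : Fin m =>
        if h : ∃ k, s k = l then {superdiag (f h.choose)}
        else Finset.univ.filter fun x : Fin n × Fin n => x.1 = x.2 := by
    ext κ
    simp only [Finset.mem_filter, Finset.mem_univ, true_and, Fintype.mem_piFinset]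
    constructor
    · intro hκ l
      split_ifs with hl
      · rw [Finset.mem_singleton, ← hκ.1, hl.choose_spec]
      · simpa using hκ.2 l hl
    · intro hκ
      refine ⟨fun k => ?_, fun l hl => ?_⟩
      · have hk : ∃ k', s k' = s k := ⟨k, rfl⟩
        have h1 := hκ (s k)
        rw [dif_pos hk, Finset.mem_singleton] at h1
        rw [h1, s.injective hk.choose_spec]
      · have h1 := hκ l
        rw [dif_neg (show ¬ ∃ k, s k = l from hl)] at h1
        simpa using h1
  have h2 : ∀ l : Fin m, (if h : ∃ k, s k = l then {superdiag (f h.choose)}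
        else Finset.univ.filter fun x : Fin n × Fin n => x.1 = x.2).card
        = if l ∈ Finset.univ.map s then 1 else n := by
    intro l
    by_cases hl : ∃ k, s k = l
    · rw [dif_pos hl, if_pos (by simpa using hl), Finset.card_singleton]
    · rw [dif_neg hl, if_neg (by simpa using hl), card_diagonal]
  rw [h, Fintype.card_piFinset, Finset.prod_congr rfl fun k _ => h2 k, Finset.prod_ite,
    Finset.prod_const_one, one_mul, Finset.prod_const]
  congr 1
  rw [Finset.filter_not, Finset.filter_mem_eq_inter, Finset.univ_inter,
    ← Finset.compl_eq_univ_sdiff, Finset.card_compl, Finset.card_map, Finset.card_univ, Fintype.card_fin, Fintype.card_fin]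

open Classical in
-- The permutations preserving `orbitRep` act simply transitively on the labellings `(s, f)` of `κ`
-- by precomposition.
theorem card_labellings_of_isFull {n m : ℕ} {κ : Fin m → Fin n × Fin n} (hκ : IsFull κ) :
    ((Finset.univ.filter fun x : (Fin (n - 1) ↪ Fin m) × (Fin (n - 1) → Fin (n - 1)) =>
      ∀ k, orbitRep (x.2 k) = orbitRep k).filter fun x => IsLabelling κ x.1 x.2).card
      = 2 ^ ((n - 1) / 2) := by
  obtain ⟨s, f, hf, h⟩ := hκ
  rw [← card_perm_orbitRep, ← Finset.card_univ]
  symm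
  refine Finset.card_bij
    (fun g _ => (g.1.toEmbedding.trans s, f ∘ g.1)) ?_ ?_ ?_
  · rintro ⟨g, hg⟩ -
    simp only [Finset.mem_filter, Finset.mem_univ, true_and, Function.comp_apply]
    refine ⟨fun k => (hf _).trans (congrFun hg k), fun k => h.1 _, fun l hl => h.2 l ?_⟩
    rintro ⟨k, rfl⟩
    exact hl ⟨g.symm k, by simp⟩
  · rintro ⟨g, hg⟩ - ⟨g', hg'⟩ - heq
    rw [Subtype.mk.injEq]
    ext1 k
    exact s.injective (DFunLike.congr_fun (congrArg Prod.fst heq) k)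
  · rintro ⟨s', f'⟩ hx
    simp only [Finset.mem_filter, Finset.mem_univ, true_and] at hx
    obtain ⟨hf', h'⟩ := hx
    have hr : ∀ k, ∃ k', s k' = s' k := by
      intro k
      have := (h'.mem_range_iff (s' k)).1 ⟨k, rfl⟩
      exact (h.mem_range_iff (s' k)).2 this
    choose g hg using hr
    have hgi : Function.Injective g := by
      intro a b hab
      apply s'.injective
      rw [← hg, ← hg, hab]
    have hff : ∀ k, f (g k) = f' k := by
      intro k
      apply superdiag_injective
      rw [← h.1, ← h'.1, hg]
    refine ⟨⟨Equiv.ofBijective g (Finite.injective_iff_bijective.1 hgi), ?_⟩,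
      Finset.mem_univ _, ?_⟩
    · funext k
      simp only [Function.comp_apply, Equiv.ofBijective_apply]
      rw [← hf, hff, hf']
    · refine Prod.ext ?_ ?_
      · ext1 k
        exact hg k
      · funext k
        exact hff k

open Classical in
theorem card_isFull (n m : ℕ) :
    (Finset.univ.filter fun κ : Fin m → Fin n × Fin n => IsFull κ).card
      = 2 ^ ((n - 1) / 2) * m.descFactorial (n - 1) * n ^ (m - (n - 1)) := by
  -- Double counting of the incidences between pairs `(s, f)` and full `κ`. There are `4 ^ ((n - 1)
  -- / 2)` choices of `f` for each `s`, but each `κ` is hit `2 ^ ((n - 1) / 2)` times.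
  have key := Finset.sum_card_bipartiteAbove_eq_sum_card_bipartiteBelow
    (s := Finset.univ.filter fun x : (Fin (n - 1) ↪ Fin m) × (Fin (n - 1) → Fin (n - 1)) =>
      ∀ k, orbitRep (x.2 k) = orbitRep k)
    (t := Finset.univ.filter fun κ : Fin m → Fin n × Fin n => IsFull κ)
    (r := fun x κ => IsLabelling κ x.1 x.2)
  have h1 : ∀ x ∈ Finset.univ.filter
      fun x : (Fin (n - 1) ↪ Fin m) × (Fin (n - 1) → Fin (n - 1)) =>
        ∀ k, orbitRep (x.2 k) = orbitRep k,
      ((Finset.univ.filter fun κ : Fin m → Fin n × Fin n => IsFull κ).bipartiteAbove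
        (fun x κ => IsLabelling κ x.1 x.2) x).card = n ^ (m - (n - 1)) := by
    intro x hx
    rw [← card_isLabelling x.1 x.2, Finset.bipartiteAbove, Finset.filter_filter]
    congr 1
    ext κ
    simp only [Finset.mem_filter, Finset.mem_univ, true_and, and_iff_right_iff_imp] at hx ⊢
    exact fun h => ⟨x.1, x.2, hx, h⟩
  have h2 : ∀ κ ∈ Finset.univ.filter fun κ : Fin m → Fin n × Fin n => IsFull κ,
      ((Finset.univ.filter fun x : (Fin (n - 1) ↪ Fin m) × (Fin (n - 1) → Fin (n - 1)) =>
      ∀ k, orbitRep (x.2 k) = orbitRep k).bipartiteBelow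
        (fun x κ => IsLabelling κ x.1 x.2) κ).card = 2 ^ ((n - 1) / 2) := by
    intro κ hκ
    exact card_labellings_of_isFull (by simpa using hκ)
  rw [Finset.sum_congr rfl h1, Finset.sum_congr rfl h2, Finset.sum_const, Finset.sum_const,
    smul_eq_mul, smul_eq_mul] at key
  have h3 : (Finset.univ.filter fun x : (Fin (n - 1) ↪ Fin m) × (Fin (n - 1) → Fin (n - 1)) =>
      ∀ k, orbitRep (x.2 k) = orbitRep k).card
      = m.descFactorial (n - 1) * 2 ^ (2 * ((n - 1) / 2)) := by
    rw [← card_orbitRep_preserving, ← Finset.univ_product_univ,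
      Finset.filter_product_right (fun f : Fin (n - 1) → Fin (n - 1) =>
        ∀ k, orbitRep (f k) = orbitRep k), Finset.card_product, Finset.card_univ,
      Fintype.card_embedding_eq, Fintype.card_fin, Fintype.card_fin]
  rw [h3] at key
  apply Nat.eq_of_mul_eq_mul_right (show 0 < 2 ^ ((n - 1) / 2) by positivity)
  rw [← key]
  ring

open Classical in
-- Enlarge the set of off-diagonal places to a set of exactly `r` places. These have `n ^ 2`
-- positions each, the others `n`, and there are at most `m ^ r` such sets.
theorem card_offDiag_le (n m r : ℕ) (hr : r ≤ m) :
    (Finset.univ.filter fun κ : Fin m → Fin n × Fin n =>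
      (Finset.univ.filter fun l => (κ l).1 ≠ (κ l).2).card ≤ r).card ≤ m ^ r * n ^ (m + r) := by
  have hsub : (Finset.univ.filter fun κ : Fin m → Fin n × Fin n =>
      (Finset.univ.filter fun l => (κ l).1 ≠ (κ l).2).card ≤ r)
      ⊆ (Finset.univ.powersetCard r).biUnion fun A : Finset (Fin m) =>
        Fintype.piFinset fun l => if l ∈ A then Finset.univ
          else Finset.univ.filter fun x : Fin n × Fin n => x.1 = x.2 := by
    intro κ hκ
    simp only [Finset.mem_filter, Finset.mem_univ, true_and] at hκ
    obtain ⟨A, hA, hc⟩ := Finset.exists_superset_card_eq hκ (by simpa using hr)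
    rw [Finset.mem_biUnion]
    refine ⟨A, by simp [hc], ?_⟩
    rw [Fintype.mem_piFinset]
    intro l
    split_ifs with hl
    · simp
    · by_contra hne
      exact hl (hA (by simpa using hne))
  refine (Finset.card_le_card hsub).trans (Finset.card_biUnion_le.trans ?_)
  have hc : ∀ A ∈ Finset.univ.powersetCard r, (Fintype.piFinset fun l : Fin m =>
      if l ∈ A then Finset.univ
        else Finset.univ.filter fun x : Fin n × Fin n => x.1 = x.2).card = n ^ (m + r) := by
    intro A hA
    have hA' : A.card = r := (Finset.mem_powersetCard.1 hA).2
    have h2 : ∀ l : Fin m, (if l ∈ A then Finset.univ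
        else Finset.univ.filter fun x : Fin n × Fin n => x.1 = x.2).card
        = n * if l ∈ A then n else 1 := by
      intro l
      split_ifs
      · rw [Finset.card_univ, Fintype.card_prod, Fintype.card_fin]
      · rw [card_diagonal, mul_one]
    rw [Fintype.card_piFinset, Finset.prod_congr rfl fun k _ => h2 k, Finset.prod_mul_distrib,
      Finset.prod_const, Finset.card_univ, Fintype.card_fin, Finset.prod_ite, Finset.prod_const_one,
      mul_one, Finset.prod_const, Finset.filter_mem_eq_inter, Finset.univ_inter, hA', pow_add]
  rw [Finset.sum_congr rfl hc, Finset.sum_const, Finset.card_powersetCard, Finset.card_univ,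
    Fintype.card_fin, smul_eq_mul]
  exact Nat.mul_le_mul_right _ (Nat.choose_le_pow _ _)

end UT

/-! ### Monotone paths and the positions they pick. -/

namespace UT

/-- The entry of `x` that occurs at the position `(i, j)` of `x` (for `b = false`) or of
`x^∗` (for `b = true`). -/
def flipPos {n : ℕ} (b : Bool) (x : Fin n × Fin n) : Fin n × Fin n :=
  if b then (x.2.rev, x.1.rev) else x

theorem flipPos_fst_eq_snd_iff {n : ℕ} (b : Bool) (x : Fin n × Fin n) :
    (flipPos b x).1 = (flipPos b x).2 ↔ x.1 = x.2 := by
  cases b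
  · simp [flipPos]
  · simp [flipPos, eq_comm]

theorem flipPos_superdiag {n : ℕ} (b : Bool) (k : Fin (n - 1)) :
    flipPos b (superdiag k) = superdiag (if b then k.rev else k) := by
  have hk := k.2
  cases b
  · simp [flipPos]
  · simp only [flipPos, superdiag, if_true, Prod.mk.injEq, Fin.ext_iff, Fin.val_rev]
    omega

theorem orbitRep_ite_rev {N : ℕ} (b : Bool) (k : Fin N) :
    orbitRep (if b then k.rev else k) = orbitRep k := by
  rw [orbitRep_eq_iff]
  cases b <;> simp

/-- In the word with letters `σ 0, …, σ (m - 1)`, starred according to `b`, the product along the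
path `p` picks the entry at the position `κ l` from the letter `l`. -/
structure IsPath {n m : ℕ} (κ : Fin m → Fin n × Fin n) (σ : Equiv.Perm (Fin m)) (b : Fin m → Bool)
    (p : Fin (m + 1) → Fin n) : Prop where
  monotone : Monotone p
  apply_eq : ∀ q, κ (σ q) = flipPos (b q) (p q.castSucc, p q.succ)

theorem IsPath.card_le_or_isFull {n m : ℕ} (hn : 1 < n) {κ : Fin m → Fin n × Fin n}
    {σ : Equiv.Perm (Fin m)} {b : Fin m → Bool} {p : Fin (m + 1) → Fin n} (h : IsPath κ σ b p) :
    (Finset.univ.filter fun l => (κ l).1 ≠ (κ l).2).card ≤ n - 2 ∨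
      (IsFull κ ∧ (p 0 : ℕ) = 0 ∧ (p (Fin.last m) : ℕ) = n - 1) := by
  rw [or_iff_not_imp_left]
  intro hcard
  have hoff : ∀ q, (κ (σ q)).1 ≠ (κ (σ q)).2 ↔ p q.castSucc ≠ p q.succ := by
    intro q
    rw [h.apply_eq, Ne, flipPos_fst_eq_snd_iff]
  have hlt : ∀ q : Fin m, p q.castSucc ≠ p q.succ → p q.castSucc < p q.succ := fun q hq =>
    lt_of_le_of_ne (h.monotone (Fin.castSucc_lt_succ).le) hq
  have hstep : ∀ q q' : Fin m, q < q' → p q.succ ≤ p q'.castSucc := fun q q' hq =>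
    h.monotone (by rw [Fin.le_def]; exact hq)
  have hinj : ∀ q q' : Fin m, p q.castSucc ≠ p q.succ → p q'.castSucc ≠ p q'.succ →
      p q.castSucc = p q'.castSucc → q = q' := by
    intro q q' hq hq' heq
    rcases lt_trichotomy q q' with hl | hl | hl
    · exact absurd heq ((hlt q hq).trans_le (hstep q q' hl)).ne
    · exact hl
    · exact absurd heq.symm ((hlt q' hq').trans_le (hstep q' q hl)).ne
  have hJ : (Finset.univ.filter fun l => (κ l).1 ≠ (κ l).2).card
      = Fintype.card {q : Fin m // p q.castSucc ≠ p q.succ} := by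
    rw [← Fintype.card_subtype]
    refine (Fintype.card_congr (σ.subtypeEquiv fun q => ?_)).symm
    rw [hoff]
  -- Distinct off-diagonal steps start in distinct rows, all below `n - 1`. With more than `n - 2`
  -- such steps, every row below `n - 1` is the start of exactly one.
  let g : {q : Fin m // p q.castSucc ≠ p q.succ} → Fin (n - 1) := fun q =>
    ⟨p q.1.castSucc, by
      have := hlt q.1 q.2
      rw [Fin.lt_def] at this
      omega⟩
  have hg : Function.Injective g := by
    intro q q' hqq
    exact Subtype.ext (hinj _ _ q.2 q'.2 (Fin.ext (Fin.mk.inj hqq)))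
  have hgb : Function.Bijective g := by
    rw [Fintype.bijective_iff_injective_and_card]
    refine ⟨hg, ?_⟩
    have := Fintype.card_le_of_injective g hg
    rw [Fintype.card_fin] at this ⊢
    omega
  have hgs : ∀ k : Fin (n - 1), ∃ q : Fin m, p q.castSucc ≠ p q.succ ∧ (p q.castSucc : ℕ) = k := by
    intro k
    obtain ⟨q, hq⟩ := hgb.2 k
    exact ⟨q.1, q.2, congrArg Fin.val hq⟩
  choose t ht htk using hgs
  -- The step out of row `k + 1` comes later, so the step out of row `k` cannot jump past `k + 1`.
  -- For the last `k` the bound is the size of the matrix.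
  have hsucc : ∀ k : Fin (n - 1), (p (t k).succ : ℕ) = k + 1 := by
    intro k
    have h1 := hlt _ (ht k)
    rw [Fin.lt_def, htk] at h1
    by_cases hk : (k : ℕ) + 1 < n - 1
    · have h2 := htk ⟨k + 1, hk⟩
      have h3 : t k < t ⟨k + 1, hk⟩ := by
        by_contra hle
        have h4 : p (t ⟨k + 1, hk⟩).castSucc ≤ p (t k).castSucc :=
          h.monotone (by rw [Fin.le_def]; exact not_lt.1 hle)
        rw [Fin.le_def, h2, htk] at h4
        simp at h4
      have h5 := hstep _ _ h3
      rw [Fin.le_def, h2] at h5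
      simp only at h5
      omega
    · have := (p (t k).succ).2
      omega
  have htp : ∀ k, (p (t k).castSucc, p (t k).succ) = superdiag k := fun k =>
    Prod.ext (Fin.ext (htk k)) (Fin.ext (hsucc k))
  have htinj : Function.Injective t := by
    intro k k' hkk
    apply Fin.ext
    rw [← htk, ← htk, hkk]
  refine ⟨⟨⟨fun k => σ (t k), σ.injective.comp htinj⟩, fun k => if b (t k) then k.rev else k,
    fun k => orbitRep_ite_rev _ _, fun k => ?_, fun l hl => ?_⟩, ?_, ?_⟩
  · change κ (σ (t k)) = _
    rw [h.apply_eq, htp, flipPos_superdiag]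
  · by_contra hne
    apply hl
    obtain ⟨q, rfl⟩ := σ.surjective l
    have hq := (hoff q).1 hne
    refine ⟨g ⟨q, hq⟩, congrArg σ ?_⟩
    exact hinj _ _ (ht _) hq (Fin.ext (htk _))
  · have h1 : p 0 ≤ p (t ⟨0, by omega⟩).castSucc := h.monotone (Fin.zero_le _)
    rw [Fin.le_def, htk] at h1
    simpa using h1
  · have h1 : p (t ⟨n - 2, by omega⟩).succ ≤ p (Fin.last m) := h.monotone (Fin.le_last _)
    rw [Fin.le_def, hsucc] at h1
    have := (p (Fin.last m)).2
    simp only at h1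
    omega

theorem IsFull.exists_isPath {n m : ℕ} (hn : 1 < n) {κ : Fin m → Fin n × Fin n} (hκ : IsFull κ) :
    ∃ (σ : Equiv.Perm (Fin m)) (b : Fin m → Bool) (p : Fin (m + 1) → Fin n),
      IsPath κ σ b p ∧ (p 0 : ℕ) = 0 ∧ (p (Fin.last m) : ℕ) = n - 1 := by
  classical
  obtain ⟨s, f, hf, hs, hd⟩ := hκ
  -- Sorting by this key puts the letters in the order: diagonal at `0`, then `s 0`, diagonal at
  -- `1`, then `s 1`, and so on. Half the key, rounded down, is the row in which a letter starts.
  let F : Fin m → ℕ := fun l =>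
    if h : ∃ k, s k = l then 2 * (h.choose : ℕ) + 1 else 2 * ((κ l).1 : ℕ)
  have hFs : ∀ k, F (s k) = 2 * (k : ℕ) + 1 := by
    intro k
    have h : ∃ k', s k' = s k := ⟨k, rfl⟩
    change (if h : ∃ k', s k' = s k then 2 * (h.choose : ℕ) + 1 else _) = _
    rw [dif_pos h, s.injective h.choose_spec]
  have hFd : ∀ l, l ∉ Set.range s → F l = 2 * ((κ l).1 : ℕ) := fun l hl => dif_neg hl
  have hFle : ∀ l, F l ≤ 2 * (n - 1) := by
    intro l
    by_cases hl : l ∈ Set.range s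
    · obtain ⟨k, rfl⟩ := hl
      rw [hFs]
      omega
    · rw [hFd l hl]
      omega
  let σ := Tuple.sort F
  have hmono : Monotone (F ∘ σ) := Tuple.monotone_sort F
  have hatt : ∀ k : ℕ, k < n - 1 → ∃ q, F (σ q) = 2 * k + 1 := by
    intro k hk
    exact ⟨σ.symm (s ⟨k, hk⟩), by rw [Equiv.apply_symm_apply, hFs]⟩
  have hbefore : ∀ (q : Fin m) (k : ℕ), k < n - 1 → F (σ q) < 2 * k + 1 →
      ∃ q', q < q' ∧ F (σ q') = 2 * k + 1 := by
    intro q k hk hlt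
    obtain ⟨q', hq'⟩ := hatt k hk
    refine ⟨q', ?_, hq'⟩
    by_contra hle
    have : F (σ q') ≤ F (σ q) := hmono (not_lt.1 hle)
    omega
  have hodd : ∀ q q', F (σ q) = F (σ q') → F (σ q) % 2 = 1 → q = q' := by
    have h1 : ∀ l, F l % 2 = 1 → ∃ k, s k = l := by
      intro l hl
      by_contra hn
      rw [hFd l hn] at hl
      omega
    intro q q' heq ho
    obtain ⟨k, hk⟩ := h1 _ ho
    obtain ⟨k', hk'⟩ := h1 _ (heq ▸ ho)
    rw [← hk, ← hk', hFs, hFs] at heq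
    apply σ.injective
    rw [← hk, ← hk', Fin.ext (show (k : ℕ) = k' by omega)]
  let p : Fin (m + 1) → Fin n :=
    Fin.snoc (fun q : Fin m => (⟨F (σ q) / 2, by have := hFle (σ q); omega⟩ : Fin n))
      ⟨n - 1, by omega⟩
  have hpc : ∀ q : Fin m, (p q.castSucc : ℕ) = F (σ q) / 2 := by
    intro q
    simp [p]
  have hpl : (p (Fin.last m) : ℕ) = n - 1 := by
    simp [p]
  -- Every odd key below `2 * (n - 1)` occurs exactly once. Hence the sorted keys cannot skip a row,
  -- and the row advances precisely after an odd key.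
  have hps : ∀ q : Fin m, (p q.succ : ℕ) = (F (σ q) + 1) / 2 := by
    intro q
    by_cases hq : (q : ℕ) + 1 < m
    · have hq1 : q.succ = (⟨q + 1, hq⟩ : Fin m).castSucc := Fin.ext rfl
      rw [hq1, hpc]
      have hle : F (σ q) ≤ F (σ ⟨q + 1, hq⟩) := hmono (by rw [Fin.le_def]; simp)
      have hle2 := hFle (σ ⟨q + 1, hq⟩)
      have hnext : ∀ k : ℕ, k < n - 1 → F (σ q) < 2 * k + 1 →
          F (σ ⟨q + 1, hq⟩) ≤ 2 * k + 1 := by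
        intro k hk hlt
        obtain ⟨q', hq', he⟩ := hbefore q k hk hlt
        rw [← he]
        exact hmono (by rw [Fin.le_def]; exact hq')
      rcases Nat.mod_two_eq_zero_or_one (F (σ q)) with he | ho
      · by_cases hc : F (σ q) / 2 < n - 1
        · have := hnext _ hc (by omega)
          omega
        · omega
      · have hne : F (σ q) ≠ F (σ ⟨q + 1, hq⟩) := by
          intro heq
          have := congrArg Fin.val (hodd _ _ heq ho)
          simp at this
        by_cases hc : F (σ q) / 2 + 1 < n - 1
        · have := hnext _ hc (by omega)
          omega
        · omega
    · have hq1 : q.succ = Fin.last m := Fin.ext (by have := q.2; simp; omega)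
      rw [hq1, hpl]
      obtain ⟨q', hq'⟩ := hatt (n - 2) (by omega)
      have h1 : F (σ q') ≤ F (σ q) := hmono (by rw [Fin.le_def]; omega)
      have h2 := hFle (σ q)
      omega
  -- The letter `s k` is starred exactly when its position is the mirror image of `k` rather than
  -- `k` itself. Diagonal letters are never starred.
  refine ⟨σ, fun q => if h : ∃ k, s k = σ q then decide (f h.choose ≠ h.choose) else false, p,
    ⟨?_, ?_⟩, ?_, hpl⟩
  · rw [Fin.monotone_iff_le_succ]
    intro q
    rw [Fin.le_def, hpc, hps]
    omega
  · intro q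
    by_cases hq : ∃ k, s k = σ q
    · simp only [dif_pos hq]
      obtain ⟨k, hk⟩ : ∃ k, hq.choose = k := ⟨_, rfl⟩
      have hkq : s k = σ q := hk ▸ hq.choose_spec
      have hp : (p q.castSucc, p q.succ) = superdiag k := by
        refine Prod.ext (Fin.ext ?_) (Fin.ext ?_)
        · rw [hpc, ← hkq, hFs]
          simp only [superdiag]
          omega
        · rw [hps, ← hkq, hFs]
          simp only [superdiag]
          omega
      rw [hk, hp, flipPos_superdiag, ← hkq, hs]
      congr 1
      by_cases hfk : f k = k
      · simp [hfk]
      · simpa [hfk] using ((orbitRep_eq_iff _ _).1 (hf k)).resolve_left hfk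
    · simp only [dif_neg hq]
      have h1 : F (σ q) = 2 * ((κ (σ q)).1 : ℕ) := hFd _ hq
      have h2 := hd _ hq
      refine Prod.ext (Fin.ext ?_) (Fin.ext ?_)
      · simp only [flipPos, Bool.false_eq_true, if_false]
        rw [hpc, h1]
        omega
      · simp only [flipPos, Bool.false_eq_true, if_false]
        rw [hps, h1, ← h2]
        omega
  · obtain ⟨q, hq⟩ := hatt 0 (by omega)
    have hm : 0 < m := lt_of_le_of_lt (Nat.zero_le _) q.2
    have h0 : (0 : Fin (m + 1)) = (⟨0, hm⟩ : Fin m).castSucc := Fin.ext rfl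
    have h1 : F (σ ⟨0, hm⟩) ≤ F (σ q) := hmono (by rw [Fin.le_def]; simp)
    rw [h0, hpc]
    omega

end UT

/-! ### Entries of matrix products along paths. -/

/-- If in the row reached by the path `p` only the entry on `p` survives at each step, then the
entry of the product at the ends of `p` is the product of the entries along `p`. -/
theorem Matrix.prod_ofFn_apply_of_path {ι R : Type*} [Fintype ι] [DecidableEq ι] [CommSemiring R]
    {m : ℕ} (M : Fin m → Matrix ι ι R) (p : Fin (m + 1) → ι)
    (h : ∀ q k, k ≠ p q.succ → M q (p q.castSucc) k = 0) :
    (List.ofFn M).prod (p 0) (p (Fin.last m)) = ∏ q, M q (p q.castSucc) (p q.succ) := by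
  induction m with
  | zero => simp
  | succ m ih =>
    rw [List.ofFn_succ, List.prod_cons, Matrix.mul_apply, Fin.prod_univ_succ,
      Finset.sum_eq_single (p (Fin.succ 0))]
    · have := ih (fun q => M q.succ) (fun q => p q.succ) fun q k hk => h q.succ k hk
      rw [Fin.succ_last] at this
      rw [this]
      rfl
    · intro k _ hk
      have := h 0 k hk
      rw [Fin.castSucc_zero] at this
      rw [this, zero_mul]
    · simp

theorem Matrix.exists_path_of_prod_ofFn_ne_zero {ι R : Type*} [Fintype ι] [DecidableEq ι]
    [CommSemiring R] {m : ℕ} (M : Fin m → Matrix ι ι R) {i j : ι}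
    (h : (List.ofFn M).prod i j ≠ 0) :
    ∃ p : Fin (m + 1) → ι, p 0 = i ∧ p (Fin.last m) = j ∧
      ∀ q, M q (p q.castSucc) (p q.succ) ≠ 0 := by
  induction m generalizing i with
  | zero =>
    refine ⟨fun _ => i, rfl, ?_, fun q => q.elim0⟩
    by_contra hij
    simp [Matrix.one_apply_ne hij] at h
  | succ m ih =>
    rw [List.ofFn_succ, List.prod_cons, Matrix.mul_apply] at h
    obtain ⟨k, -, hk⟩ := Finset.exists_ne_zero_of_sum_ne_zero h
    obtain ⟨p, hp0, hpl, hp⟩ := ih (fun q => M q.succ) (right_ne_zero_of_mul hk)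
    refine ⟨Fin.cons i p, rfl, ?_, fun q => ?_⟩
    · rw [← Fin.succ_last, Fin.cons_succ, hpl]
    · refine Fin.cases ?_ (fun q => ?_) q
      · rw [Fin.castSucc_zero, Fin.cons_zero, Fin.cons_succ, hp0]
        exact left_ne_zero_of_mul hk
      · rw [← Fin.succ_castSucc, Fin.cons_succ, Fin.cons_succ]
        exact hp q

/-! ### Evaluating words on homogeneous matrices. -/

namespace UT

/-- Sending all generators to `1` measures the length of the degree. The truncated subtraction is
right for `j < i` too, where the defining list is empty. -/
theorem lift_degree_eta {n : ℕ} (i j : Fin n) :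
    FreeGroup.lift (fun _ : Fin (n - 1) => Multiplicative.ofAdd (1 : ℤ)) (degree (eta n) i j)
      = Multiplicative.ofAdd (((j : ℕ) - (i : ℕ) : ℕ) : ℤ) := by
  have hj := j.2
  rw [degree, map_list_prod, List.map_drop, List.map_take, List.map_ofFn]
  have : (⇑(FreeGroup.lift fun _ : Fin (n - 1) => Multiplicative.ofAdd (1 : ℤ)) ∘ eta n)
      = fun _ => Multiplicative.ofAdd (1 : ℤ) := by
    funext k
    simp [eta]
  rw [this, List.ofFn_const, List.take_replicate, List.drop_replicate, List.prod_replicate,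
    ← ofAdd_nsmul, min_eq_left (by omega)]
  simp

theorem degree_eta_sub {n : ℕ} {i j i' j' : Fin n}
    (h : degree (eta n) i j = degree (eta n) i' j') : (j : ℕ) - i = j' - i' := by
  have := lift_degree_eta i j
  rw [h, lift_degree_eta] at this
  exact_mod_cast (Multiplicative.ofAdd.injective this).symm

/-- `inv` is the reflection along the secondary diagonal, twisted by the nonzero scalars `ε`. -/
structure IsTwistedReflection {F : Type*} [Field F] {n : ℕ}
    (inv : HomogeneousInvolution (grading F (eta n)) (grpStar n)) (ε : Fin n → F) : Prop where
  ne_zero : ∀ i, ε i ≠ 0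
  apply_eq : ∀ M i j, (inv.toLin M).1 i j = ε i * M.1 j.rev i.rev * ε j

theorem isTwistedReflection_orthogonal (F : Type*) [Field F] (n : ℕ) :
    IsTwistedReflection (orthogonal F n) fun _ => 1 where
  ne_zero _ := one_ne_zero
  apply_eq M i j := by
    rw [one_mul, mul_one]
    rfl

theorem isTwistedReflection_symplectic (F : Type*) [Field F] (n : ℕ) (hn : Even n) :
    IsTwistedReflection (symplectic F n hn) fun i => if (i : ℕ) < n / 2 then 1 else -1 where
  ne_zero i := by split_ifs <;> simp
  apply_eq := conjReflect_apply F n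

variable {F : Type*} [Field F] {n m : ℕ}

/-- The word with letters `x_{σ 0}, …, x_{σ (m - 1)}` of degrees given by `μ`, starred according
to `b`. -/
noncomputable def word (F : Type*) [Field F] {n m : ℕ} (μ : Fin m → Grp n)
    (σ : Equiv.Perm (Fin m)) (b : Fin m → Bool) : FreeStarAlgebra F (Grp n) :=
  (List.ofFn fun k : Fin m => FreeStarAlgebra.starVar F (μ (σ k)) (σ k : ℕ) (b k)).prod

/-- The matrix substituted for the `q`-th letter of a word. -/
noncomputable def letterMatrix (inv : HomogeneousInvolution (grading F (eta n)) (grpStar n))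
    (a : Grp n → ℕ → algebra F n) (μ : Fin m → Grp n) (σ : Equiv.Perm (Fin m)) (b : Fin m → Bool)
    (q : Fin m) : Matrix (Fin n) (Fin n) F :=
  if b q then (inv.toLin (a (μ (σ q)) (σ q))).1 else (a (μ (σ q)) (σ q)).1

theorem eval_word (inv : HomogeneousInvolution (grading F (eta n)) (grpStar n))
    (a : Grp n → ℕ → algebra F n) (μ : Fin m → Grp n) (σ : Equiv.Perm (Fin m))
    (b : Fin m → Bool) :
    (inv.eval a (word F μ σ b)).1 = (List.ofFn (letterMatrix inv a μ σ b)).prod := by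
  change (algebra F n).val (inv.eval a (word F μ σ b)) = _
  rw [word, map_list_prod, map_list_prod, List.map_ofFn, List.map_ofFn]
  congr 2
  funext q
  rw [Function.comp_apply, Function.comp_apply, FreeStarAlgebra.starVar_eq,
    HomogeneousInvolution.eval, FreeAlgebra.lift_ι_apply, letterMatrix]
  split_ifs <;> rfl

/-- The scalar by which the entry `(x, y)` of the image of a matrix, starred or not, differs from
an entry of the matrix. -/
def twist (ε : Fin n → F) (b : Bool) (x : Fin n × Fin n) : F := if b then ε x.1 * ε x.2 else 1

theorem letterMatrix_apply {inv : HomogeneousInvolution (grading F (eta n)) (grpStar n)}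
    {ε : Fin n → F} (hε : IsTwistedReflection inv ε)
    (a : Grp n → ℕ → algebra F n) (μ : Fin m → Grp n) (σ : Equiv.Perm (Fin m)) (b : Fin m → Bool)
    (q : Fin m) (x : Fin n × Fin n) :
    letterMatrix inv a μ σ b q x.1 x.2 = twist ε (b q) x *
      (a (μ (σ q)) (σ q)).1 (flipPos (b q) x).1 (flipPos (b q) x).2 := by
  rw [letterMatrix, twist, flipPos]
  split_ifs
  · rw [hε.apply_eq]
    ring
  · rw [one_mul]

theorem flipPos_fst_le_snd_iff (b : Bool) (x : Fin n × Fin n) :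
    (flipPos b x).1 ≤ (flipPos b x).2 ↔ x.1 ≤ x.2 := by
  cases b <;> simp [flipPos]

/-- This is the rigidity behind uniqueness of paths. The length of the degree alone gives the
distance from the row to the column, and the reflection preserves that distance. -/
theorem flipPos_degree_injective {b : Bool} {x y z : Fin n} (hy : x ≤ y) (hz : x ≤ z)
    (h : degree (eta n) (flipPos b (x, y)).1 (flipPos b (x, y)).2
      = degree (eta n) (flipPos b (x, z)).1 (flipPos b (x, z)).2) : y = z := by
  have h1 := degree_eta_sub h
  have hy' := y.2
  have hz' := z.2
  rw [Fin.le_def] at hy hz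
  apply Fin.ext
  cases b
  · simp only [flipPos, Bool.false_eq_true, if_false] at h1
    omega
  · simp only [flipPos, if_true, Fin.val_rev] at h1
    omega

theorem le_and_degree_of_ne_zero {g : Grp n} {M : algebra F n} (hM : M ∈ grading F (eta n) g)
    {i j : Fin n} (h : M.1 i j ≠ 0) : i ≤ j ∧ degree (eta n) i j = g :=
  ⟨not_lt.1 fun hlt => h (M.2 _ _ hlt), hM i j h⟩

theorem eval_word_apply_of_isPath {inv : HomogeneousInvolution (grading F (eta n)) (grpStar n)}
    {ε : Fin n → F} (hε : IsTwistedReflection inv ε) {κ : Fin m → Fin n × Fin n}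
    {σ : Equiv.Perm (Fin m)} {b : Fin m → Bool} {p : Fin (m + 1) → Fin n} (hp : IsPath κ σ b p)
    {a : Grp n → ℕ → algebra F n} (ha : ∀ g i, a g i ∈ grading F (eta n) g) :
    (inv.eval a (word F (fun l => degree (eta n) (κ l).1 (κ l).2) σ b)).1 (p 0) (p (Fin.last m))
      = (∏ q, twist ε (b q) (p q.castSucc, p q.succ)) *
        ∏ l, (a (degree (eta n) (κ l).1 (κ l).2) l).1 (κ l).1 (κ l).2 := by
  have hle : ∀ q : Fin m, p q.castSucc ≤ p q.succ := fun q =>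
    hp.monotone (Fin.castSucc_lt_succ).le
  rw [eval_word, Matrix.prod_ofFn_apply_of_path]
  · rw [← Equiv.prod_comp σ fun l => (a (degree (eta n) (κ l).1 (κ l).2) l).1 (κ l).1 (κ l).2,
      ← Finset.prod_mul_distrib]
    refine Finset.prod_congr rfl fun q _ => ?_
    rw [letterMatrix_apply hε _ _ _ _ _ (p q.castSucc, p q.succ), ← hp.apply_eq]
  · intro q k hk
    by_contra hne
    rw [letterMatrix_apply hε _ _ _ _ _ (p q.castSucc, k)] at hne
    obtain ⟨h1, h2⟩ := le_and_degree_of_ne_zero (ha _ _) (right_ne_zero_of_mul hne)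
    rw [flipPos_fst_le_snd_iff] at h1
    rw [hp.apply_eq] at h2
    exact hk (flipPos_degree_injective h1 (hle q) h2)

/-- A nonzero entry of the product has a path of nonzero factors. Reading off the positions along it
recovers `κ`, and homogeneity then forces the degrees `μ`. -/
theorem exists_isPath_of_eval_word_ne_zero
    {inv : HomogeneousInvolution (grading F (eta n)) (grpStar n)}
    {ε : Fin n → F} (hε : IsTwistedReflection inv ε) {μ : Fin m → Grp n}
    {σ : Equiv.Perm (Fin m)} {b : Fin m → Bool}
    {a : Grp n → ℕ → algebra F n} (ha : ∀ g i, a g i ∈ grading F (eta n) g) {i j : Fin n}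
    (h : (inv.eval a (word F μ σ b)).1 i j ≠ 0) :
    ∃ κ p, IsPath κ σ b p ∧ p 0 = i ∧ p (Fin.last m) = j ∧
      μ = fun l => degree (eta n) (κ l).1 (κ l).2 := by
  rw [eval_word] at h
  obtain ⟨p, hp0, hpl, hp⟩ := Matrix.exists_path_of_prod_ofFn_ne_zero _ h
  have key : ∀ q, p q.castSucc ≤ p q.succ ∧
      degree (eta n) (flipPos (b q) (p q.castSucc, p q.succ)).1
        (flipPos (b q) (p q.castSucc, p q.succ)).2 = μ (σ q) := by
    intro q
    have hq := hp q
    rw [letterMatrix_apply hε _ _ _ _ _ (p q.castSucc, p q.succ)] at hq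
    obtain ⟨h1, h2⟩ := le_and_degree_of_ne_zero (ha _ _) (right_ne_zero_of_mul hq)
    rw [flipPos_fst_le_snd_iff] at h1
    exact ⟨h1, h2⟩
  refine ⟨fun l => flipPos (b (σ.symm l)) (p (σ.symm l).castSucc, p (σ.symm l).succ), p,
    ⟨Fin.monotone_iff_le_succ.2 fun q => (key q).1, fun q => by rw [Equiv.symm_apply_apply]⟩,
    hp0, hpl, ?_⟩
  funext l
  rw [(key (σ.symm l)).2, Equiv.apply_symm_apply]

/-! ### Upper bound for the codimension by counting monomials. -/

/-- The substitutions of homogeneous matrices of the right degrees for all variables. -/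
abbrev Substitution (F : Type*) [Field F] (n : ℕ) : Type _ :=
  {a : Grp n → ℕ → algebra F n // ∀ g i, a g i ∈ grading F (eta n) g}

/-- The relatively free algebra, realized by the values of its elements under all
substitutions. -/
noncomputable def valueMap (inv : HomogeneousInvolution (grading F (eta n)) (grpStar n)) :
    (FreeStarAlgebra F (Grp n) ⧸ inv.identities) →ₗ[F]
      (Substitution F n → Matrix (Fin n) (Fin n) F) :=
  Submodule.liftQ inv.identities
    (LinearMap.pi fun a => (algebra F n).val.toLinearMap ∘ₗ (inv.eval a.1).toLinearMap) <| by
      intro f hf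
      rw [LinearMap.mem_ker]
      funext a
      have : inv.eval a.1 f = 0 := hf a.1 a.2
      simp [this]

theorem valueMap_mkQ (inv : HomogeneousInvolution (grading F (eta n)) (grpStar n))
    (f : FreeStarAlgebra F (Grp n)) (a : Substitution F n) :
    valueMap inv (inv.identities.mkQ f) a = (inv.eval a.1 f).1 := rfl

theorem valueMap_injective (inv : HomogeneousInvolution (grading F (eta n)) (grpStar n)) :
    Function.Injective (valueMap inv) := by
  rw [← LinearMap.ker_eq_bot, valueMap, Submodule.ker_liftQ_eq_bot]
  intro f hf a ha
  exact Subtype.ext (congrFun (LinearMap.mem_ker.1 hf) ⟨a, ha⟩)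

/-- The value of a monomial in the entries of generic matrices, placed at `(i, j)`. -/
noncomputable def monomialValue (F : Type*) [Field F] {n m : ℕ}
    (x : (Fin m → Fin n × Fin n) × Fin n × Fin n) :
    Substitution F n → Matrix (Fin n) (Fin n) F :=
  fun a => Matrix.single x.2.1 x.2.2
    (∏ l, (a.1 (degree (eta n) (x.1 l).1 (x.1 l).2) l).1 (x.1 l).1 (x.1 l).2)

open Classical in
/-- The monomials in entries of generic matrices that occur in the values of words. -/
noncomputable def attained (n m : ℕ) : Finset ((Fin m → Fin n × Fin n) × Fin n × Fin n) :=
  Finset.univ.filter fun x => ∃ σ b p, IsPath x.1 σ b p ∧ p 0 = x.2.1 ∧ p (Fin.last m) = x.2.2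

theorem valueMap_word_mem {inv : HomogeneousInvolution (grading F (eta n)) (grpStar n)}
    {ε : Fin n → F} (hε : IsTwistedReflection inv ε) (μ : Fin m → Grp n)
    (σ : Equiv.Perm (Fin m)) (b : Fin m → Bool) :
    valueMap inv (inv.identities.mkQ (word F μ σ b)) ∈
      Submodule.span F (monomialValue F (n := n) (m := m) '' (attained n m)) := by
  have hsum : valueMap inv (inv.identities.mkQ (word F μ σ b))
      = ∑ i, ∑ j, fun a => Matrix.single i j ((inv.eval a.1 (word F μ σ b)).1 i j) := by
    funext a
    rw [valueMap_mkQ, Finset.sum_apply]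
    simp only [Finset.sum_apply]
    exact Matrix.matrix_eq_sum_single _
  rw [hsum]
  refine Submodule.sum_mem _ fun i _ => Submodule.sum_mem _ fun j _ => ?_
  -- One substitution with a nonzero entry yields a path, and that path then computes this entry for
  -- all substitutions.
  by_cases h : ∃ a : Substitution F n, (inv.eval a.1 (word F μ σ b)).1 i j ≠ 0
  · obtain ⟨a, ha⟩ := h
    obtain ⟨κ, p, hp, rfl, rfl, rfl⟩ := exists_isPath_of_eval_word_ne_zero hε a.2 ha
    have : (fun a : Substitution F n => Matrix.single (p 0) (p (Fin.last m))
        ((inv.eval a.1 (word F (fun l => degree (eta n) (κ l).1 (κ l).2) σ b)).1 (p 0)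
          (p (Fin.last m))))
        = (∏ q, twist ε (b q) (p q.castSucc, p q.succ)) •
          monomialValue F (κ, p 0, p (Fin.last m)) := by
      funext a
      rw [eval_word_apply_of_isPath hε hp a.2, Pi.smul_apply, monomialValue, Matrix.smul_single,
        smul_eq_mul]
    rw [this]
    refine Submodule.smul_mem _ _ (Submodule.subset_span ⟨_, ?_, rfl⟩)
    simp only [attained, Finset.coe_filter, Finset.mem_univ, true_and, Set.mem_ofPred_eq]
    exact ⟨σ, b, p, hp, rfl, rfl⟩
  · push Not at h
    have : (fun a : Substitution F n => Matrix.single i j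
        ((inv.eval a.1 (word F μ σ b)).1 i j)) = 0 := by
      funext a
      rw [h a, Matrix.single_zero]
      rfl
    rw [this]
    exact Submodule.zero_mem _

/-- The subspace of multilinear elements of length `m` in the relatively free algebra. -/
noncomputable abbrev multilinearPart
    (inv : HomogeneousInvolution (grading F (eta n)) (grpStar n)) (m : ℕ) :
    Submodule F (FreeStarAlgebra F (Grp n) ⧸ inv.identities) :=
  ⨆ μ : Fin m → Grp n, (multilinearStar F μ).map inv.identities.mkQ

theorem map_valueMap_le {inv : HomogeneousInvolution (grading F (eta n)) (grpStar n)}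
    {ε : Fin n → F} (hε : IsTwistedReflection inv ε) (m : ℕ) :
    (multilinearPart inv m).map (valueMap inv) ≤
      Submodule.span F (monomialValue F (n := n) (m := m) '' (attained n m)) := by
  rw [Submodule.map_le_iff_le_comap]
  refine iSup_le fun μ => ?_
  rw [Submodule.map_le_iff_le_comap, multilinearStar, Submodule.span_le]
  rintro _ ⟨⟨σ, b⟩, rfl⟩
  exact valueMap_word_mem hε μ σ b

theorem finite_span_monomialValue (F : Type*) [Field F] (n m : ℕ) :
    Module.Finite F (Submodule.span F (monomialValue F (n := n) (m := m) '' (attained n m))) :=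
  FiniteDimensional.span_of_finite F ((attained n m).finite_toSet.image _)

theorem codim_le_card_attained {inv : HomogeneousInvolution (grading F (eta n)) (grpStar n)}
    {ε : Fin n → F} (hε : IsTwistedReflection inv ε) (m : ℕ) :
    inv.codim m ≤ (attained n m).card := by
  classical
  have := finite_span_monomialValue F n m
  have h1 : inv.codim m = Module.finrank F ((multilinearPart inv m).map (valueMap inv)) :=
    (LinearEquiv.finrank_eq (Submodule.equivMapOfInjective (valueMap inv)
      (valueMap_injective inv) (multilinearPart inv m)))
  rw [h1]
  refine (Submodule.finrank_mono (map_valueMap_le hε m)).trans ?_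
  rw [← Finset.coe_image]
  exact (finrank_span_finset_le_card _).trans Finset.card_image_le

/-- Needed for the lower bound: `finrank` would be `0` on an infinite-dimensional space. -/
theorem finite_multilinearPart {inv : HomogeneousInvolution (grading F (eta n)) (grpStar n)}
    {ε : Fin n → F} (hε : IsTwistedReflection inv ε) (m : ℕ) :
    Module.Finite F (multilinearPart inv m) := by
  have := finite_span_monomialValue F n m
  have h1 := Submodule.finiteDimensional_of_le (map_valueMap_le hε m)
  exact Module.Finite.equiv (Submodule.equivMapOfInjective (valueMap inv)
      (valueMap_injective inv) (multilinearPart inv m)).symm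

/-! ### Lower bound from the full assignments, and the size of the error. -/

open Classical in
/-- The substitution of matrix units for the variables that makes the monomial given by `κ`
nonzero. -/
noncomputable def unitSubstitution (F : Type*) [Field F] {n m : ℕ} (κ : Fin m → Fin n × Fin n)
    (hκ : ∀ l, (κ l).1 ≤ (κ l).2) : Substitution F n :=
  ⟨fun g i => if h : ∃ hi : i < m, degree (eta n) (κ ⟨i, hi⟩).1 (κ ⟨i, hi⟩).2 = g then
      ⟨Matrix.single (κ ⟨i, h.choose⟩).1 (κ ⟨i, h.choose⟩).2 1, fun x y hxy =>
        Matrix.single_apply_of_ne _ _ _ _ _ fun he =>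
          absurd (hκ ⟨i, h.choose⟩) (by rw [he.1, he.2]; exact hxy.not_ge)⟩
    else 0, by
    intro g i
    dsimp only
    split_ifs with h
    · intro x y hxy
      by_cases he : (κ ⟨i, h.choose⟩).1 = x ∧ (κ ⟨i, h.choose⟩).2 = y
      · rw [← he.1, ← he.2]
        exact h.choose_spec
      · exact absurd (Matrix.single_apply_of_ne _ _ _ _ _ he) hxy
    · exact Submodule.zero_mem _⟩

open Classical in
theorem unitSubstitution_apply (κ : Fin m → Fin n × Fin n)
    (hκ : ∀ l, (κ l).1 ≤ (κ l).2) (l : Fin m) (x : Fin n × Fin n) :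
    ((unitSubstitution F κ hκ).1 (degree (eta n) x.1 x.2) l).1 x.1 x.2
      = if κ l = x then 1 else 0 := by
  rw [unitSubstitution]
  dsimp only
  by_cases h1 : ∃ hi : (l : ℕ) < m,
      degree (eta n) (κ ⟨l, hi⟩).1 (κ ⟨l, hi⟩).2 = degree (eta n) x.1 x.2
  · rw [dif_pos h1]
    by_cases h2 : κ l = x
    · simp [h2]
    · rw [if_neg h2]
      exact Matrix.single_apply_of_ne _ _ _ _ _ fun he => h2 (Prod.ext he.1 he.2)
  · rw [dif_neg h1, if_neg fun h2 => h1 ⟨l.2, by rw [← h2]⟩]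
    rfl

theorem IsFull.fst_le_snd {κ : Fin m → Fin n × Fin n} (hκ : IsFull κ) (l : Fin m) :
    (κ l).1 ≤ (κ l).2 := by
  obtain ⟨s, f, -, hs, hd⟩ := hκ
  by_cases hl : l ∈ Set.range s
  · obtain ⟨k, rfl⟩ := hl
    rw [hs]
    simp [superdiag]
  · exact (hd l hl).le

theorem card_isFull_le_codim {inv : HomogeneousInvolution (grading F (eta n)) (grpStar n)}
    {ε : Fin n → F} (hε : IsTwistedReflection inv ε) (hn : 1 < n) (m : ℕ) :
    Nat.card {κ : Fin m → Fin n × Fin n // IsFull κ} ≤ inv.codim m := by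
  classical
  have := finite_multilinearPart hε m
  choose σ b p hp hp0 hpl using
    fun κ : {κ : Fin m → Fin n × Fin n // IsFull κ} => κ.2.exists_isPath hn
  let w := fun κ : {κ : Fin m → Fin n × Fin n // IsFull κ} =>
    word F (fun l => degree (eta n) (κ.1 l).1 (κ.1 l).2) (σ κ) (b κ)
  have hw : ∀ κ, inv.identities.mkQ (w κ) ∈ multilinearPart inv m := fun κ =>
    Submodule.mem_iSup_of_mem (fun l => degree (eta n) (κ.1 l).1 (κ.1 l).2)
      (Submodule.mem_map_of_mem (Submodule.subset_span ⟨(σ κ, b κ), rfl⟩))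
  -- At the corner entry, the words and the substitutions of matrix units form a diagonal system
  -- with nonzero diagonal, which gives linear independence.
  have hval : ∀ κ κ', valueMap inv (inv.identities.mkQ (w κ))
      (unitSubstitution F κ'.1 κ'.2.fst_le_snd) ⟨0, by omega⟩ ⟨n - 1, by omega⟩
      = (∏ q, twist ε (b κ q) (p κ q.castSucc, p κ q.succ)) * if κ' = κ then 1 else 0 := by
    intro κ κ'
    have h := eval_word_apply_of_isPath hε (hp κ) (unitSubstitution F κ'.1 κ'.2.fst_le_snd).2
    rw [Fin.ext (hp0 κ) (b := ⟨0, by omega⟩), Fin.ext (hpl κ) (b := ⟨n - 1, by omega⟩)] at h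
    rw [valueMap_mkQ, h]
    congr 1
    simp only [unitSubstitution_apply]
    split_ifs with hk
    · subst hk
      simp
    · obtain ⟨l, hl⟩ : ∃ l, κ'.1 l ≠ κ.1 l := by
        by_contra hall
        push Not at hall
        exact hk (Subtype.ext (funext hall))
      exact Finset.prod_eq_zero (Finset.mem_univ l) (if_neg hl)
  have hli : LinearIndependent F fun κ : {κ : Fin m → Fin n × Fin n // IsFull κ} =>
      (⟨inv.identities.mkQ (w κ), hw κ⟩ : multilinearPart inv m) := by
    rw [Fintype.linearIndependent_iff]
    intro c hc κ'
    have h1 := congrArg (fun x : multilinearPart inv m => valueMap inv x.1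
      (unitSubstitution F κ'.1 κ'.2.fst_le_snd) ⟨0, by omega⟩ ⟨n - 1, by omega⟩) hc
    simp only [Submodule.coe_sum, Submodule.coe_smul, map_sum, map_smul, Finset.sum_apply,
      Matrix.sum_apply, Pi.smul_apply, Matrix.smul_apply, hval, Submodule.coe_zero, map_zero,
      Pi.zero_apply, Matrix.zero_apply, smul_eq_mul, mul_ite, mul_one, mul_zero, Finset.sum_ite_eq,
      Finset.mem_univ, if_true] at h1
    refine (mul_eq_zero.1 h1).resolve_right (Finset.prod_ne_zero_iff.2 fun q _ => ?_)
    rw [twist]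
    split_ifs
    · exact mul_ne_zero (hε.ne_zero _) (hε.ne_zero _)
    · exact one_ne_zero
  rw [Nat.card_eq_fintype_card]
  exact hli.fintype_card_le_finrank

open Classical in
-- A full `κ` counts once because its ends are forced to be the corner. Any other `κ` has at most `n
-- - 2` off-diagonal places. The factor `n ^ n` is `n ^ (n - 2)` from these places times `n ^ 2` for
-- the ends.
theorem card_attained_le (hn : 1 < n) (hm : n - 2 ≤ m) :
    (attained n m).card ≤ (Finset.univ.filter fun κ : Fin m → Fin n × Fin n => IsFull κ).card
      + n ^ n * m ^ (n - 2) * n ^ m := by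
  let i₀ : Fin n := ⟨0, by omega⟩
  let j₀ : Fin n := ⟨n - 1, by omega⟩
  have hsub : attained n m ⊆
      (Finset.univ.filter fun κ : Fin m → Fin n × Fin n => IsFull κ) ×ˢ {(i₀, j₀)} ∪
      (Finset.univ.filter fun κ : Fin m → Fin n × Fin n =>
        (Finset.univ.filter fun l => (κ l).1 ≠ (κ l).2).card ≤ n - 2) ×ˢ Finset.univ := by
    rintro ⟨κ, i, j⟩ hx
    simp only [attained, Finset.mem_filter, Finset.mem_univ, true_and] at hx
    obtain ⟨σ, b, p, hp, rfl, rfl⟩ := hx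
    rw [Finset.mem_union, Finset.mem_product, Finset.mem_product]
    rcases hp.card_le_or_isFull hn with h | ⟨h, h0, hl⟩
    · exact Or.inr ⟨by simpa using h, Finset.mem_univ _⟩
    · refine Or.inl ⟨by simpa using h, ?_⟩
      rw [Finset.mem_singleton]
      exact Prod.ext (Fin.ext h0) (Fin.ext hl)
  refine (Finset.card_le_card hsub).trans ((Finset.card_union_le _ _).trans ?_)
  rw [Finset.card_product, Finset.card_product, Finset.card_singleton, mul_one, Finset.card_univ,
    Fintype.card_prod, Fintype.card_fin]
  refine Nat.add_le_add_left ((Nat.mul_le_mul_right _ (card_offDiag_le n m (n - 2) hm)).trans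
    (le_of_eq ?_)) _
  obtain ⟨k, rfl⟩ : ∃ k, n = k + 2 := ⟨n - 2, by omega⟩
  rw [Nat.add_sub_cancel]
  ring

end UT

/-! ### Asymptotics and conclusion. -/

theorem Filter.Tendsto.rpow_one_div_of_isEquivalent {u : ℕ → ℝ} {C a : ℝ} {d : ℕ} (hC : 0 < C)
    (ha : 0 < a) (h : u ~[atTop] fun m : ℕ => C * (m : ℝ) ^ d * a ^ m) :
    Tendsto (fun m : ℕ => u m ^ ((1 : ℝ) / (m : ℝ))) atTop (𝓝 a) := by
  obtain ⟨φ, hφ, hu⟩ := h.exists_eq_mul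
  have hinv : Tendsto (fun m : ℕ => (1 : ℝ) / (m : ℝ)) atTop (𝓝 0) :=
    tendsto_one_div_atTop_nhds_zero_nat
  have h1 : Tendsto (fun m : ℕ => φ m ^ ((1 : ℝ) / (m : ℝ))) atTop (𝓝 1) := by
    simpa using hφ.rpow hinv (Or.inl one_ne_zero)
  have h2 : Tendsto (fun m : ℕ => C ^ ((1 : ℝ) / (m : ℝ))) atTop (𝓝 1) := by
    simpa using (tendsto_const_nhds (x := C)).rpow hinv (Or.inl hC.ne')
  have h3 : Tendsto (fun m : ℕ => ((m : ℝ) ^ ((1 : ℝ) / (m : ℝ))) ^ d) atTop (𝓝 1) := by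
    simpa using (tendsto_rpow_div.comp tendsto_natCast_atTop_atTop).pow d
  have h4 := ((h1.mul h2).mul h3).mul_const a
  rw [one_mul, one_mul, one_mul] at h4
  refine h4.congr' ?_
  filter_upwards [hu, hφ.eventually (lt_mem_nhds zero_lt_one), eventually_gt_atTop 0]
    with m hm hpos hm0
  have hm0' : (m : ℝ) ≠ 0 := by exact_mod_cast hm0.ne'
  have hmn : (0 : ℝ) ≤ m := Nat.cast_nonneg m
  rw [hm, Pi.mul_apply, Real.mul_rpow hpos.le (by positivity),
    Real.mul_rpow (by positivity) (by positivity), Real.mul_rpow hC.le (by positivity),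
    ← Real.rpow_natCast a m, ← Real.rpow_mul ha.le, mul_one_div_cancel hm0', Real.rpow_one,
    ← Real.rpow_natCast, ← Real.rpow_natCast, ← Real.rpow_mul hmn, ← Real.rpow_mul hmn,
    mul_comm (d : ℝ)]
  ring

theorem isLittleO_pow_mul_pow (C a : ℝ) {d e : ℕ} (hde : d < e) :
    (fun m : ℕ => C * (m : ℝ) ^ d * a ^ m) =o[atTop] fun m : ℕ => (m : ℝ) ^ e * a ^ m := by
  refine IsLittleO.mul_isBigO ?_ (isBigO_refl _ _)
  refine IsLittleO.const_mul_left ?_ C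
  exact (isLittleO_pow_pow_atTop_of_lt hde).comp_tendsto tendsto_natCast_atTop_atTop

theorem mainTheorem2 (F : Type*) [Field F] [CharZero F] (n : ℕ) (hn : 1 < n)
    (inv : HomogeneousInvolution (UT.grading F (UT.eta n)) (UT.grpStar n))
    (hinv : inv = UT.orthogonal F n ∨ ∃ he : Even n, inv = UT.symplectic F n he) :
    ((fun m : ℕ => (inv.codim m : ℝ)) ~[atTop]
      fun m : ℕ => (2 : ℝ) ^ ((n - 1) / 2) / (n : ℝ) ^ (n - 1) * (m : ℝ) ^ (n - 1) * (n : ℝ) ^ m) ∧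
    Tendsto (fun m : ℕ => (inv.codim m : ℝ) ^ ((1 : ℝ) / (m : ℝ))) atTop (𝓝 (n : ℝ)) := by
  classical
  obtain ⟨ε, hε⟩ : ∃ ε : Fin n → F, UT.IsTwistedReflection inv ε := by
    rcases hinv with rfl | ⟨he, rfl⟩
    · exact ⟨_, UT.isTwistedReflection_orthogonal F n⟩
    · exact ⟨_, UT.isTwistedReflection_symplectic F n he⟩
  have hn0 : (n : ℝ) ≠ 0 := by
    have : n ≠ 0 := by omega
    exact_mod_cast this
  set K : ℕ → ℕ := fun m => 2 ^ ((n - 1) / 2) * m.descFactorial (n - 1) * n ^ (m - (n - 1))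
  set C : ℝ := (2 : ℝ) ^ ((n - 1) / 2) / (n : ℝ) ^ (n - 1)
  have hC : 0 < C := by positivity
  have hK : (fun m : ℕ => (K m : ℝ)) ~[atTop]
      fun m : ℕ => C * (m : ℝ) ^ (n - 1) * (n : ℝ) ^ m := by
    refine (((IsEquivalent.refl (u := fun _ : ℕ => C)).mul
      (isEquivalent_descFactorial (n - 1))).mul
        (IsEquivalent.refl (u := fun m : ℕ => (n : ℝ) ^ m))).congr_left ?_
    -- Only for `m ≥ n - 1` is the truncated exponent `m - (n - 1)` a true difference, which
    -- produces the denominator of `C`.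
    filter_upwards [eventually_ge_atTop (n - 1)] with m hm
    simp only [Pi.mul_apply, K, C]
    push_cast
    rw [pow_sub₀ _ hn0 hm]
    field_simp
  have hsmall : (fun m : ℕ => (inv.codim m : ℝ) - K m) =o[atTop]
      fun m : ℕ => C * (m : ℝ) ^ (n - 1) * (n : ℝ) ^ m := by
    -- The codimension lies between the number `K m` of full assignments and `K m` plus the number
    -- of remaining triples, which is smaller by a factor of order `m`.
    have h1 : (fun m : ℕ => (inv.codim m : ℝ) - K m) =O[atTop]
        fun m : ℕ => (n : ℝ) ^ n * (m : ℝ) ^ (n - 2) * (n : ℝ) ^ m := by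
      refine IsBigO.of_bound 1 ?_
      filter_upwards [eventually_ge_atTop (n - 2)] with m hm
      have hlow := UT.card_isFull_le_codim hε hn m
      have hup := (UT.codim_le_card_attained hε m).trans (UT.card_attained_le hn hm)
      rw [UT.card_isFull] at hup
      rw [Nat.card_eq_fintype_card, Fintype.card_subtype, UT.card_isFull] at hlow
      have hlow' : (K m : ℝ) ≤ inv.codim m := by exact_mod_cast hlow
      have hup' : (inv.codim m : ℝ) ≤ K m + (n : ℝ) ^ n * (m : ℝ) ^ (n - 2) * (n : ℝ) ^ m := by
        exact_mod_cast hup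
      rw [Real.norm_of_nonneg (by linarith), Real.norm_of_nonneg (by positivity)]
      linarith
    refine h1.trans_isLittleO ((isLittleO_pow_mul_pow _ _ (show n - 2 < n - 1 by omega)).trans_isBigO ?_)
    simp only [mul_assoc]
    exact isBigO_self_const_mul hC.ne' _ _
  have hmain : (fun m : ℕ => (inv.codim m : ℝ)) ~[atTop]
      fun m : ℕ => C * (m : ℝ) ^ (n - 1) * (n : ℝ) ^ m := by
    have := hK.add_isLittleO hsmall
    refine this.congr_left (Eventually.of_forall fun m => ?_)
    simp
  exact ⟨hmain, Filter.Tendsto.rpow_one_div_of_isEquivalent hC (by positivity) hmain⟩
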